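/- Let $\kappa$ be an infinite cardinal and let $x$ be a good ultrafilter on $\kappa$; that is, for every $H\colon[\kappa]^{<\omega}\to x$ there is $K\colon\kappa\to x$ such that $K(\alpha_1)\cap\dots\cap K(\alpha_n)\subseteq H(\{\alpha_1,\dots,\alpha_n\})$ for every nonempty finite set $\{\alpha_1,\dots,\alpha_n\}\subseteq\kappa$. Fix an infinite cardinal $\lambda<\kappa$ and let $\theta>2^\kappa$ be a regular cardinal. Let $H(\theta)$ be the collection of all sets whose transitive closure has size less than $\theta$, and let $M\prec H(\theta)$ be an elementary submodel in the language $\{\in\}$, with $x,\kappa\in M$ and $\kappa\subset M$. Assume that $M$ is $\lambda$-covering, i.e. for every $E\in[M]^\lambda$ there is $F\in[M]^\lambda$ with $E\subseteq F$ and $F\in M$. Assume also that $\lambda^+$ is not a Jónsson cardinal, where a cardinal $\mu$ is Jónsson if for every $\psi\colon[\mu]^{<\omega}\to\mu$ there is $W\in[\mu]^\mu$ such that $\psi([W]^{<\omega})$ is a proper subset of $\mu$. Let $\mathcal B=\mathcal P(\kappa)\cap M$, a Boolean algebra of subsets of $\kappa$, let $\mathrm{st}(\mathcal B)$ be its Stone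 space (the ultrafilters of $\mathcal B$, with the sets $\{p : b\in p\}$, $b\in\mathcal B$, as a base of open sets), and let $\Gamma\colon\beta\kappa\to\mathrm{st}(\mathcal B)$, $\Gamma(z)=z\cap\mathcal B$, be the natural map. Then $\Gamma(x)$ is a weak $P_{\lambda^+}$-point of $\mathrm{st}(\mathcal B)$; that is, $\Gamma(x)$ is not in the closure of any $S\subseteq\mathrm{st}(\mathcal B)\setminus\{\Gamma(x)\}$ with $|S|<\lambda^+$. -/

import Mathlib

open Cardinal

universe u v

/-! ### The language of set theory, and elementary submodels of `H(θ)` -/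

/-- The relation symbols of the language of set theory: one binary symbol. -/
inductive MemRelSymb : ℕ → Type
  | mem : MemRelSymb 2

/-- The language of set theory `{∈}` (equality is a logical symbol). -/
def setLanguage : FirstOrder.Language := ⟨fun _ => Empty, MemRelSymb⟩

/-- The membership symbol. -/
def memSymb : setLanguage.Relations 2 := MemRelSymb.mem

/-- `H(θ)`: the collection of all sets whose transitive closure has size less than `θ`.
The elements of the transitive closure of `a` are the `y` with
`y ∈ y₁ ∈ ⋯ ∈ yₙ ∈ a` for some `n ≥ 0`. -/
def HSet (θ : Cardinal.{u}) : Set ZFSet.{u} :=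
  {a | #{y : ZFSet.{u} | Relation.TransGen (· ∈ ·) y a} < lift.{u + 1} θ}

/-- `H(θ)` as a structure for the language of set theory, with the true membership relation. -/
instance HSet.instStructure (θ : Cardinal.{u}) : setLanguage.Structure (HSet θ) where
  funMap := fun f => f.elim
  RelMap := fun r =>
    match r with
    | MemRelSymb.mem => fun t => (t 0 : ZFSet.{u}) ∈ (t 1 : ZFSet.{u})

theorem HSet.relMap_memSymb {θ : Cardinal.{u}} (t : Fin 2 → HSet θ) :
    FirstOrder.Language.Structure.RelMap memSymb t ↔ (t 0 : ZFSet.{u}) ∈ (t 1 : ZFSet.{u}) :=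
  Iff.rfl

/-- The sets that belong to an elementary submodel `M ≺ H(θ)`. -/
def modelSets {θ : Cardinal.{u}} (M : setLanguage.ElementarySubstructure (HSet θ)) :
    Set ZFSet.{u} :=
  {a | ∃ h : a ∈ HSet θ, (⟨a, h⟩ : HSet θ) ∈ M}

/-- `M` is `μ`-covering: every `E ∈ [M]^μ` is contained in some `F ∈ [M]^μ` with `F ∈ M`. -/
def IsCovering (μ : Cardinal.{u}) (M : Set ZFSet.{u}) : Prop :=
  ∀ E : ZFSet.{u}, (E : Set ZFSet.{u}) ⊆ M → E.card = μ →
    ∃ F : ZFSet.{u}, (F : Set ZFSet.{u}) ⊆ M ∧ F.card = μ ∧ E ⊆ F ∧ F ∈ M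

/-! ### Cardinals as von Neumann ordinals, Jónsson cardinals -/

/-- The cardinal `κ` as a set: the initial von Neumann ordinal of size `κ`. -/
noncomputable def cardSet (κ : Cardinal.{u}) : ZFSet.{u} := κ.ord.toZFSet

/-- `κ` is a Jónsson cardinal: for every `ψ : [κ]^{<ω} → κ` there is `W ∈ [κ]^κ` such that
`ψ([W]^{<ω})` is a proper subset of `κ`. -/
def IsJonsson (κ : Cardinal.{u}) : Prop :=
  ∀ ψ : Finset (cardSet κ) → cardSet κ, ∃ W : Set (cardSet κ),
    #W = lift.{u + 1} κ ∧ ψ '' {s : Finset (cardSet κ) | (s : Set (cardSet κ)) ⊆ W} ≠ Set.univ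

/-! ### Good ultrafilters -/

/-- An ultrafilter `x` on `X` is good if for every `H : [X]^{<ω} → x` there is `K : X → x` with
`K a₁ ∩ ⋯ ∩ K aₙ ⊆ H {a₁, …, aₙ}` for all nonempty finite sets `{a₁, …, aₙ} ⊆ X`. -/
def IsGood {X : Type v} (x : Ultrafilter X) : Prop :=
  ∀ H : Finset X → Set X, (∀ s, H s ∈ x) →
    ∃ K : X → Set X, (∀ a, K a ∈ x) ∧ ∀ s : Finset X, s.Nonempty → (⋂ a ∈ s, K a) ⊆ H s

/-! ### Weak `P_μ`-points -/

/-- `y` is a weak `P_μ`-point of `Y`: it is not in the closure of any subset of `Y \ {y}` of size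
less than `μ`. -/
def IsWeakPPoint {Y : Type v} [TopologicalSpace Y] (μ : Cardinal.{v}) (y : Y) : Prop :=
  ∀ S : Set Y, S ⊆ {y}ᶜ → #S < μ → y ∉ closure S

/-! ### The Stone space of a Boolean algebra -/

/-- The points of the Stone space of a Boolean algebra `B`: the ultrafilters of `B`. -/
@[ext]
structure StonePoint (B : Type v) [BooleanAlgebra B] where
  carrier : Set B
  top_mem : ⊤ ∈ carrier
  bot_notMem : ⊥ ∉ carrier
  inf_mem : ∀ a b, a ∈ carrier → b ∈ carrier → a ⊓ b ∈ carrier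
  mem_of_le : ∀ a b, a ∈ carrier → a ≤ b → b ∈ carrier
  mem_or_compl_mem : ∀ a, a ∈ carrier ∨ aᶜ ∈ carrier

/-- The Stone topology, with the sets `{p | b ∈ p}`, `b ∈ B`, as a base. -/
instance StonePoint.instTopologicalSpace (B : Type v) [BooleanAlgebra B] :
    TopologicalSpace (StonePoint B) :=
  TopologicalSpace.generateFrom {U | ∃ b : B, U = {p : StonePoint B | b ∈ p.carrier}}

/-- For a field `B` of subsets of `X`, the natural map from the space of ultrafilters on `X` to the
Stone space of `B`, sending `x` to `x ∩ B`. -/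
def stoneRestrict {X : Type v} (B : BooleanSubalgebra (Set X)) (x : Ultrafilter X) :
    StonePoint B where
  carrier := {A | (A : Set X) ∈ x}
  top_mem := by
    change Set.univ ∈ x
    exact Filter.univ_mem
  bot_notMem := by
    change ∅ ∉ x
    exact x.empty_notMem
  inf_mem := fun _ _ ha hb => Filter.inter_mem ha hb
  mem_of_le := fun _ _ ha hab => Filter.mem_of_superset ha hab
  mem_or_compl_mem := fun a => x.mem_or_compl_mem (a : Set X)

/-! ### Subsets of, and ultrafilters on, a set `k`, as sets; the algebra `P(k) ∩ M` -/

/-- A subset `A` of (the elements of) the set `k`, as a set. -/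
noncomputable def subsetCode (k : ZFSet.{u}) (A : Set k) : ZFSet.{u} :=
  ZFSet.sep (fun a => ∃ h : a ∈ k, (⟨a, h⟩ : k) ∈ A) k

/-- An ultrafilter on (the elements of) the set `k`, as a set of subsets of `k`. -/
noncomputable def ultrafilterCode {k : ZFSet.{u}} (x : Ultrafilter k) : ZFSet.{u} :=
  ZFSet.sep (fun b => {a : k | (a : ZFSet.{u}) ∈ b} ∈ x) k.powerset

theorem subset_mem_HSet {θ : Cardinal.{u}} {a b : ZFSet.{u}} (hb : b ∈ HSet θ) (h : a ⊆ b) :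
    a ∈ HSet θ := by
  refine lt_of_le_of_lt (mk_le_mk_of_subset ?_) hb
  intro y hy
  change Relation.TransGen (· ∈ ·) y a at hy
  change Relation.TransGen (· ∈ ·) y b
  obtain ⟨c, hyc, hca⟩ := Relation.TransGen.tail'_iff.1 hy
  exact Relation.TransGen.tail'_iff.2 ⟨c, hyc, h hca⟩

theorem mem_HSet_of_mem {θ : Cardinal.{u}} {a b : ZFSet.{u}} (hb : b ∈ HSet θ) (h : a ∈ b) :
    a ∈ HSet θ := by
  refine lt_of_le_of_lt (mk_le_mk_of_subset ?_) hb
  intro y hy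
  exact Relation.TransGen.tail hy h

open FirstOrder FirstOrder.Language in
/-- `M ≺ H(θ)` is closed under `(k, a, b) ↦ k \ (a ∩ b)`. -/
theorem nand_mem_modelSets {θ : Cardinal.{u}} (M : setLanguage.ElementarySubstructure (HSet θ))
    {k a b : ZFSet.{u}} (hk : k ∈ modelSets M) (ha : a ∈ modelSets M) (hb : b ∈ modelSets M) :
    k \ (a ∩ b) ∈ modelSets M := by
  obtain ⟨hk, hkM⟩ := hk
  obtain ⟨ha, haM⟩ := ha
  obtain ⟨hb, hbM⟩ := hb
  have hc : k \ (a ∩ b) ∈ HSet θ := subset_mem_HSet hk (fun z hz => (ZFSet.mem_sdiff.1 hz).1)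
  let v : Fin 3 → M := ![⟨_, hkM⟩, ⟨_, haM⟩, ⟨_, hbM⟩]
  let f : Fin 3 → setLanguage.Term (Fin 3 ⊕ Fin 2) := fun i => Term.var (Sum.inl i)
  let g : Fin 2 → setLanguage.Term (Fin 3 ⊕ Fin 2) := fun i => Term.var (Sum.inr i)
  let φ : setLanguage.Formula (Fin 3) :=
    ((memSymb.boundedFormula₂ (g 1) (g 0)).iff
      (memSymb.boundedFormula₂ (g 1) (f 0) ⊓
        ∼(memSymb.boundedFormula₂ (g 1) (f 1) ⊓ memSymb.boundedFormula₂ (g 1) (f 2)))).all.ex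
  let f' : Fin 4 → setLanguage.Term (Fin 4 ⊕ Fin 1) := fun i => Term.var (Sum.inl i)
  let g' : setLanguage.Term (Fin 4 ⊕ Fin 1) := Term.var (Sum.inr 0)
  let χ : setLanguage.Formula (Fin 4) :=
    ((memSymb.boundedFormula₂ g' (f' 3)).iff
      (memSymb.boundedFormula₂ g' (f' 0) ⊓
        ∼(memSymb.boundedFormula₂ g' (f' 1) ⊓ memSymb.boundedFormula₂ g' (f' 2)))).all
  have hH : φ.Realize (((↑) : M → HSet θ) ∘ v) := by
    have : ∃ c : HSet θ, ∀ t : HSet θ,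
        t.1 ∈ c.1 ↔ (t.1 ∈ k ∧ ¬ (t.1 ∈ a ∧ t.1 ∈ b)) :=
      ⟨⟨_, hc⟩, fun t => by simp⟩
    simpa [φ, f, g, v, Formula.Realize, Fin.snoc, BoundedFormula.realize_rel₂,
      HSet.relMap_memSymb] using this
  have hM : φ.Realize v := (M.isElementary φ v).1 hH
  obtain ⟨c, hcM⟩ : ∃ c : M, χ.Realize ![v 0, v 1, v 2, c] := by
    simpa [φ, χ, f, g, f', g', Formula.Realize, Fin.snoc, BoundedFormula.realize_rel₂] using hM
  have hcH := (M.isElementary χ _).2 hcM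
  have key : ∀ t : HSet θ, t.1 ∈ c.1.1 ↔ (t.1 ∈ k ∧ ¬ (t.1 ∈ a ∧ t.1 ∈ b)) := by
    simpa [χ, f', g', v, Formula.Realize, Fin.snoc, BoundedFormula.realize_rel₂,
      HSet.relMap_memSymb] using hcH
  have hce : c.1.1 = k \ (a ∩ b) := by
    ext z
    constructor
    · intro hz
      simpa using (key ⟨z, mem_HSet_of_mem c.1.2 hz⟩).1 hz
    · intro hz
      exact (key ⟨z, mem_HSet_of_mem hc hz⟩).2 (by simpa using hz)
  rw [← hce]
  exact ⟨c.1.2, c.2⟩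

theorem subsetCode_compl_inter (k : ZFSet.{u}) (A B : Set k) :
    subsetCode k (A ∩ B)ᶜ = k \ (subsetCode k A ∩ subsetCode k B) := by
  ext z
  by_cases hz : z ∈ k <;> simp [subsetCode, hz]

/-- The Boolean algebra `P(k) ∩ M` of the subsets of `k` that belong to `M ≺ H(θ)`,
where `k ∈ M`. -/
def traceAlgebra {θ : Cardinal.{u}} (M : setLanguage.ElementarySubstructure (HSet θ))
    {k : ZFSet.{u}} (hk : k ∈ modelSets M) : BooleanSubalgebra (Set k) :=
  have nand : ∀ A B : Set k, subsetCode k A ∈ modelSets M → subsetCode k B ∈ modelSets M →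
      subsetCode k (A ∩ B)ᶜ ∈ modelSets M := fun A B hA hB => by
    rw [subsetCode_compl_inter]
    exact nand_mem_modelSets M hk hA hB
  have compl : ∀ A : Set k, subsetCode k A ∈ modelSets M → subsetCode k Aᶜ ∈ modelSets M :=
    fun A hA => by simpa using nand A A hA hA
  { carrier := {A | subsetCode k A ∈ modelSets M}
    supClosed' := fun A hA B hB => by
      have := nand _ _ (compl A hA) (compl B hB)
      rwa [Set.compl_inter, compl_compl, compl_compl] at this
    infClosed' := fun A hA B hB => by
      have := compl _ (nand A B hA hB)
      rwa [compl_compl] at this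
    compl_mem' := fun {A} hA => compl A hA
    bot_mem' := by
      have h : subsetCode k Set.univ = k := by
        ext z
        simp +contextual [subsetCode]
      have := compl Set.univ (by rw [h]; exact hk)
      rwa [Set.compl_univ] at this }

/-!
At most `λ` ultrafilters `p ≠ Γ(x)` of `P(κ) ∩ M` are to be separated from `Γ(x)` by a single
set of `x ∩ M`. Choose `b_p ∈ x ∩ M` with `b_p ∉ p`, and cover the chosen sets by some `F ∈ M` of
size `λ`.

Goodness of `x` and a function `ψ : [λ⁺]^{<ω} → λ⁺` witnessing that `λ⁺` is not Jónsson give a map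
`K : κ → x` with `⋂_{α ∈ s} K(α)` contained in the member of `F ∩ x` of index `ψ(s)`, for each
nonempty finite `s ⊆ λ⁺`. If every `K(α)`, `α < λ⁺`, belonged to one of at most `λ` filters, then
one filter would contain `K(α)` for `λ⁺` many `α`, hence all of `F ∩ x`, as `ψ` maps the finite
subsets of these `α` onto `λ⁺`. So some `K(α)` avoids all the filters, provided that none of them
contains `F ∩ x`. This is `exists_avoiding_map`.

This property of `K` is first-order over `H(θ)` (`Avoids`, `isDef_avoids`): by `|F| = λ`, a sequence
of at most `λ` filters is a relation with first coordinates in `F`, and by `2^κ < θ` all such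
relations belong to `H(θ)`, so no cardinality has to be expressed, and stating directedness in place
of the filter axioms lets the quantifier apply to ultrafilters of `P(κ) ∩ M` as they are. By
elementarity `K` can be taken in `M`; as `κ ⊆ M`, its values are in `M`, and one of them is the
required set (`exists_mem_forall_notMem`).
-/

/-! ### Good ultrafilters and functions witnessing that a cardinal is not Jónsson -/

/-- If `J` has size `λ` and `ψ` witnesses that `λ⁺ = #I` is not Jónsson, then a single map `K`
into the good ultrafilter `x` works against all `J`-indexed sequences `q` of down-directed families
each of which fails to generate all the sets of `x` listed by `G`: some value of `K` is missed by
all the families of the sequence. -/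
theorem exists_avoiding_map {X I J : Type v} {x : Ultrafilter X} (hx : IsGood x) (e : I ↪ X)
    (hJ : ℵ₀ ≤ #J) (hIJ : #I = Order.succ #J) (ψ : Finset I → I)
    (hψ : ∀ W : Set I, #W = #I → ψ '' {s : Finset I | (s : Set I) ⊆ W} = Set.univ)
    (G : J → Set X) :
    ∃ K : X → Set X, (∀ a, K a ∈ x) ∧ ∀ q : J → Set (Set X),
      (∀ j, ∀ A ∈ q j, ∀ B ∈ q j, ∃ C ∈ q j, C ⊆ A ∩ B) →
      (∀ j, ∃ i, G i ∈ x ∧ ∀ A ∈ q j, ¬ A ⊆ G i) → ∃ a, ∀ j, K a ∉ q j := by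
  classical
  have hlt : #J < #I := hIJ ▸ Order.lt_succ _
  -- Every index in `J` is listed at least twice, because `ψ ∅` can use up one occurrence.
  obtain ⟨g, hg⟩ : ∃ g : I → J × Bool, Function.Surjective g := by
    have h : #(J × Bool) ≤ #I := by
      rw [mk_prod, lift_uzero, mk_bool, lift_ofNat, mul_eq_left hJ
        ((ofNat_lt_aleph0 (n := 2)).le.trans hJ) two_ne_zero]
      exact hlt.le
    obtain ⟨f⟩ := h
    have : Nonempty (J × Bool) := by
      have : Nonempty J := mk_ne_zero_iff.1 (aleph0_pos.trans_le hJ).ne'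
      infer_instance
    exact ⟨Function.invFun f, Function.invFun_surjective f.injective⟩
  let H : Finset X → Set X := fun s =>
    let A := G (g (ψ (s.preimage e e.injective.injOn))).1
    if A ∈ x then A else Set.univ
  have hH : ∀ s, H s ∈ x := fun s => by
    dsimp only [H]
    split_ifs with h
    exacts [h, Filter.univ_mem]
  obtain ⟨K, hKx, hK⟩ := hx H hH
  refine ⟨K, hKx, fun q hdir hG => ?_⟩
  by_contra! hcon
  choose c hc using fun i : I => hcon (e i)
  obtain ⟨j, hj⟩ := infinite_pigeonhole_card_lt c hlt (hJ.trans hlt.le)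
  have hW : #(c ⁻¹' {j}) = #I :=
    le_antisymm (mk_set_le _) (hIJ ▸ Order.succ_le_of_lt hj)
  obtain ⟨i, hi, hiq⟩ := hG j
  have hs : ∃ s : Finset I, s.Nonempty ∧ (s : Set I) ⊆ c ⁻¹' {j} ∧ (g (ψ s)).1 = i := by
    obtain ⟨y₁, hy₁⟩ := hg (i, true)
    obtain ⟨y₂, hy₂⟩ := hg (i, false)
    obtain ⟨s₁, hs₁, rfl⟩ : y₁ ∈ ψ '' {s : Finset I | (s : Set I) ⊆ c ⁻¹' {j}} := by
      rw [hψ _ hW]; trivial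
    obtain ⟨s₂, hs₂, rfl⟩ : y₂ ∈ ψ '' {s : Finset I | (s : Set I) ⊆ c ⁻¹' {j}} := by
      rw [hψ _ hW]; trivial
    rcases s₁.eq_empty_or_nonempty with rfl | h₁
    · rcases s₂.eq_empty_or_nonempty with rfl | h₂
      · simp [hy₁] at hy₂
      · exact ⟨s₂, h₂, hs₂, by rw [hy₂]⟩
    · exact ⟨s₁, h₁, hs₁, by rw [hy₁]⟩
  obtain ⟨s, hne, hsW, hsi⟩ := hs
  have hsub : ∃ C ∈ q j, C ⊆ ⋂ a ∈ s, K (e a) := by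
    clear hsi
    induction hne using Finset.Nonempty.cons_induction with
    | singleton a =>
      have ha : c a = j := hsW (by simp)
      exact ⟨K (e a), ha ▸ hc a, by simp⟩
    | cons a s has hne ih =>
      have ha : c a = j := hsW (by simp)
      obtain ⟨C, hC, hCs⟩ := ih fun b hb => hsW (by simp [Finset.mem_coe.1 hb])
      obtain ⟨D, hD, hDC⟩ := hdir j _ (ha ▸ hc a) C hC
      refine ⟨D, hD, fun t ht => ?_⟩
      have h1 := (hDC ht).1
      have h2 := hCs (hDC ht).2
      simp only [Set.mem_iInter] at h2 ⊢
      intro b hb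
      rcases Finset.mem_cons.1 hb with rfl | hb
      · exact h1
      · exact h2 b hb
  obtain ⟨C, hC, hCs⟩ := hsub
  refine hiq C hC (hCs.trans ?_)
  have := hK (s.map e) (by simpa using hne)
  have hpre : (s.map e).preimage e e.injective.injOn = s := by
    ext; simp
  simpa [H, hpre, hsi, hi] using this

/-! ### Closure properties of `H(θ)` -/

theorem mem_HSet_of_card_lt {θ : Cardinal.{u}} (hθ : θ.IsRegular) {a : ZFSet.{u}}
    (ha : (a : Set ZFSet.{u}) ⊆ HSet θ) (hc : a.card < θ) : a ∈ HSet θ := by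
  have hθ' : (lift.{u + 1} θ).IsRegular := hθ.lift
  have ha' : #(a : Set ZFSet.{u}) < lift.{u + 1} θ := by
    have h := ZFSet.cardinalMk_coe_sort (x := a)
    exact (le_of_eq h).trans_lt (lift_lt.2 hc)
  have h : {y : ZFSet.{u} | Relation.TransGen (· ∈ ·) y a} ⊆
      (a : Set ZFSet.{u}) ∪
        ⋃ b ∈ (a : Set ZFSet.{u}), {y : ZFSet.{u} | Relation.TransGen (· ∈ ·) y b} := by
    intro y hy
    obtain ⟨b, hyb, hba⟩ := Relation.TransGen.tail'_iff.1 hy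
    rcases Relation.reflTransGen_iff_eq_or_transGen.1 hyb with rfl | hyb
    · exact Or.inl hba
    · exact Or.inr (Set.mem_biUnion (t := fun b => {y | Relation.TransGen (· ∈ ·) y b}) hba hyb)
  refine (mk_le_mk_of_subset h).trans_lt ((mk_union_le _ _).trans_lt
    (add_lt_of_lt hθ'.aleph0_le ha' ?_))
  exact (card_biUnion_lt_iff_forall_of_isRegular hθ' ha').2 fun b hb => ha hb

theorem HSet_pair_mem {θ : Cardinal.{u}} (hθ : θ.IsRegular) {a b : ZFSet.{u}}
    (ha : a ∈ HSet θ) (hb : b ∈ HSet θ) : ZFSet.pair a b ∈ HSet θ := by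
  have key : ∀ {c d : ZFSet.{u}}, c ∈ HSet θ → d ∈ HSet θ → ({c, d} : ZFSet.{u}) ∈ HSet θ := by
    intro c d hc hd
    refine mem_HSet_of_card_lt hθ ?_ ?_
    · intro z hz
      rcases ZFSet.mem_pair.1 hz with rfl | rfl <;> assumption
    · refine (ZFSet.card_insert_le).trans_lt ?_
      rw [ZFSet.card_singleton]
      exact_mod_cast hθ.nat_lt 2
  have hs : ({a} : ZFSet.{u}) ∈ HSet θ := by
    simpa using key ha ha
  exact key hs (key ha hb)

/-- A set of ordered pairs with coordinates in two sets of `H(θ)` is in `H(θ)`. -/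
theorem mem_HSet_of_subset_prod {θ : Cardinal.{u}} (hθ : θ.IsRegular) {a b r : ZFSet.{u}}
    (ha : (a : Set ZFSet.{u}) ⊆ HSet θ) (hb : (b : Set ZFSet.{u}) ⊆ HSet θ)
    (hac : a.card < θ) (hbc : b.card < θ) (hr : r ⊆ ZFSet.prod a b) : r ∈ HSet θ := by
  refine subset_mem_HSet (mem_HSet_of_card_lt hθ ?_ ?_) hr
  · intro z hz
    obtain ⟨c, hc, d, hd, rfl⟩ := ZFSet.mem_prod.1 hz
    exact HSet_pair_mem hθ (ha hc) (hb hd)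
  · refine lt_of_le_of_lt ?_ (mul_lt_of_lt hθ.aleph0_le hac hbc)
    rw [← lift_le.{u + 1}, lift_mul, ← ZFSet.cardinalMk_coe_sort, ← ZFSet.cardinalMk_coe_sort,
      ← ZFSet.cardinalMk_coe_sort, mul_def]
    refine mk_le_of_surjective (f := fun p : a × b =>
      ⟨ZFSet.pair p.1 p.2, ZFSet.pair_mem_prod.2 ⟨p.1.2, p.2.2⟩⟩) ?_
    rintro ⟨z, hz⟩
    obtain ⟨c, hc, d, hd, rfl⟩ := ZFSet.mem_prod.1 hz
    exact ⟨(⟨c, hc⟩, ⟨d, hd⟩), rfl⟩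

/-! ### First-order definability over `H(θ)` -/

/-- The predicate `R` of the assignments `v` is expressed by a formula of the language of set
theory, evaluated in `H(θ)`. -/
def IsDef {θ : Cardinal.{u}} {α : Type} (R : (α → HSet θ) → Prop) : Prop :=
  ∃ φ : setLanguage.Formula α, ∀ v, φ.Realize v ↔ R v

/-- The function `t` of the assignments is the value of a variable. -/
def IsVar {θ : Cardinal.{u}} {α : Type} (t : (α → HSet θ) → HSet θ) : Prop :=
  ∃ i, ∀ v, t v = v i

namespace IsDef

open FirstOrder FirstOrder.Language

variable {θ : Cardinal.{u}} {α : Type} {R S : (α → HSet θ) → Prop}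
  {s t r : (α → HSet θ) → HSet θ}

theorem mem (hs : IsVar s) (ht : IsVar t) :
    IsDef fun v => (s v : ZFSet.{u}) ∈ (t v : ZFSet.{u}) := by
  obtain ⟨i, hi⟩ := hs
  obtain ⟨j, hj⟩ := ht
  refine ⟨memSymb.formula₂ (Term.var i) (Term.var j), fun v => ?_⟩
  simp only [hi, hj]
  rw [Formula.realize_rel₂, HSet.relMap_memSymb]
  rfl

theorem eq (hs : IsVar s) (ht : IsVar t) : IsDef fun v => s v = t v := by
  obtain ⟨i, hi⟩ := hs
  obtain ⟨j, hj⟩ := ht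
  refine ⟨(Term.var i).equal (Term.var j), fun v => ?_⟩
  simp only [hi, hj]
  rw [Formula.realize_equal]
  rfl

theorem imp (hR : IsDef R) (hS : IsDef S) : IsDef fun v => R v → S v := by
  obtain ⟨φ, hφ⟩ := hR
  obtain ⟨χ, hχ⟩ := hS
  exact ⟨φ.imp χ, fun v => by rw [Formula.realize_imp, hφ, hχ]⟩

theorem not (hR : IsDef R) : IsDef fun v => ¬ R v := by
  obtain ⟨φ, hφ⟩ := hR
  exact ⟨∼φ, fun v => by rw [Formula.realize_not, hφ]⟩

theorem and (hR : IsDef R) (hS : IsDef S) : IsDef fun v => R v ∧ S v := by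
  obtain ⟨φ, hφ⟩ := hR
  obtain ⟨χ, hχ⟩ := hS
  exact ⟨φ ⊓ χ, fun v => by rw [Formula.realize_inf, hφ, hχ]⟩

theorem or (hR : IsDef R) (hS : IsDef S) : IsDef fun v => R v ∨ S v := by
  obtain ⟨φ, hφ⟩ := hR
  obtain ⟨χ, hχ⟩ := hS
  exact ⟨φ ⊔ χ, fun v => by rw [Formula.realize_sup, hφ, hχ]⟩

theorem iff (hR : IsDef R) (hS : IsDef S) : IsDef fun v => (R v ↔ S v) := by
  obtain ⟨φ, hφ⟩ := hR
  obtain ⟨χ, hχ⟩ := hS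
  exact ⟨φ.iff χ, fun v => by rw [Formula.realize_iff, hφ, hχ]⟩

theorem ex {R : (α → HSet θ) → HSet θ → Prop}
    (hR : IsDef fun w : α ⊕ Unit → HSet θ => R (fun i => w (Sum.inl i)) (w (Sum.inr ()))) :
    IsDef fun v => ∃ a, R v a := by
  obtain ⟨φ, hφ⟩ := hR
  refine ⟨φ.iExs Unit, fun v => ?_⟩
  rw [Formula.realize_iExs]
  constructor
  · rintro ⟨i, hi⟩
    exact ⟨i (), (hφ _).1 hi⟩
  · rintro ⟨a, ha⟩
    exact ⟨fun _ => a, (hφ _).2 ha⟩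

theorem all {R : (α → HSet θ) → HSet θ → Prop}
    (hR : IsDef fun w : α ⊕ Unit → HSet θ => R (fun i => w (Sum.inl i)) (w (Sum.inr ()))) :
    IsDef fun v => ∀ a, R v a := by
  have := (ex (R := fun v a => ¬ R v a) hR.not).not
  simpa only [not_exists, not_not] using this

theorem pair_mem (hs : IsVar s) (ht : IsVar t) (hr : IsVar r) :
    IsDef fun v => ZFSet.pair (s v : ZFSet.{u}) (t v) ∈ (r v : ZFSet.{u}) := by
  -- Kuratowski's `{{a}, {a, b}}`, written out in terms of membership.
  have key : IsDef fun v => ∃ z w w' : HSet θ, z.1 ∈ (r v).1 ∧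
      (∀ y : HSet θ, y.1 ∈ z.1 ↔ y = w ∨ y = w') ∧ (∀ y : HSet θ, y.1 ∈ w.1 ↔ y = s v) ∧
        ∀ y : HSet θ, y.1 ∈ w'.1 ↔ y = s v ∨ y = t v := by
    obtain ⟨i, hi⟩ := hs
    obtain ⟨j, hj⟩ := ht
    obtain ⟨k, hk⟩ := hr
    simp only [hi, hj, hk]
    refine ex (ex (ex (and (mem ?_ ?_) (and (all (iff (mem ?_ ?_) (or (eq ?_ ?_) (eq ?_ ?_))))
      (and (all (iff (mem ?_ ?_) (eq ?_ ?_)))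
        (all (iff (mem ?_ ?_) (or (eq ?_ ?_) (eq ?_ ?_)))))))))
    all_goals exact ⟨_, fun _ => rfl⟩
  convert key using 2 with v
  have single : ∀ (w : HSet θ) (c : HSet θ), (∀ y : HSet θ, y.1 ∈ w.1 ↔ y = c) ↔
      w.1 = {c.1} := by
    refine fun w c => ⟨fun h => ?_, fun h y => by rw [h, ZFSet.mem_singleton, Subtype.ext_iff]⟩
    ext y
    rw [ZFSet.mem_singleton]
    refine ⟨fun hy => congrArg Subtype.val ((h ⟨y, mem_HSet_of_mem w.2 hy⟩).1 hy), ?_⟩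
    rintro rfl
    exact (h c).2 rfl
  have double : ∀ (w : HSet θ) (c d : HSet θ), (∀ y : HSet θ, y.1 ∈ w.1 ↔ y = c ∨ y = d) ↔
      w.1 = {c.1, d.1} := by
    refine fun w c d => ⟨fun h => ?_, fun h y => by
      rw [h, ZFSet.mem_pair, Subtype.ext_iff, Subtype.ext_iff]⟩
    ext y
    rw [ZFSet.mem_pair]
    constructor
    · intro hy
      have := (h ⟨y, mem_HSet_of_mem w.2 hy⟩).1 hy
      rwa [Subtype.ext_iff, Subtype.ext_iff] at this
    · rintro (rfl | rfl)
      · exact (h c).2 (Or.inl rfl)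
      · exact (h d).2 (Or.inr rfl)
  simp only [single, double]
  constructor
  · intro h
    have hp := mem_HSet_of_mem (r v).2 h
    exact ⟨⟨_, hp⟩, ⟨{(s v).1}, mem_HSet_of_mem hp (ZFSet.mem_pair.2 (Or.inl rfl))⟩,
      ⟨{(s v).1, (t v).1}, mem_HSet_of_mem hp (ZFSet.mem_pair.2 (Or.inr rfl))⟩, h, rfl, rfl, rfl⟩
  · rintro ⟨z, w, w', hz, hzw, hw, hw'⟩
    rwa [ZFSet.pair, ← hw, ← hw', ← hzw]

/-- A definable property with parameters in `M ≺ H(θ)` that holds of some element of `H(θ)` holds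
of some element of `M`. -/
theorem exists_mem {R : (α ⊕ Unit → HSet θ) → Prop} (hR : IsDef R)
    (M : setLanguage.ElementarySubstructure (HSet θ)) (v : α → HSet θ) (hv : ∀ i, v i ∈ M)
    (h : ∃ a, R (Sum.elim v fun _ => a)) : ∃ a ∈ M, R (Sum.elim v fun _ => a) := by
  obtain ⟨φ, hφ⟩ := hR
  let v' : α → M := fun i => ⟨v i, hv i⟩
  have hH : (φ.iExs Unit).Realize (((↑) : M → HSet θ) ∘ v') := by
    obtain ⟨a, ha⟩ := h
    exact Formula.realize_iExs.2 ⟨fun _ => a, (hφ _).2 ha⟩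
  obtain ⟨a, ha⟩ := Formula.realize_iExs.1 ((M.subtype.map_formula (φ.iExs Unit) v').1 hH)
  refine ⟨a (), (a ()).2, (hφ _).1 ?_⟩
  have := (M.subtype.map_formula φ _).2 ha
  convert this using 1
  ext i
  rcases i with i | i <;> rfl

end IsDef

/-! ### Subsets and ultrafilters as sets -/

section Codes

variable {k : ZFSet.{u}}

theorem subsetCode_subset (A : Set k) : subsetCode k A ⊆ k :=
  fun _ hz => (ZFSet.mem_sep.1 hz).1

theorem mem_subsetCode {A : Set k} {a : k} : (a : ZFSet.{u}) ∈ subsetCode k A ↔ a ∈ A := by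
  simp [subsetCode]

theorem setOf_mem_subsetCode (A : Set k) : {a : k | (a : ZFSet.{u}) ∈ subsetCode k A} = A :=
  Set.ext fun _ => mem_subsetCode

theorem subsetCode_setOf_mem {b : ZFSet.{u}} (hb : b ⊆ k) :
    subsetCode k {a : k | (a : ZFSet.{u}) ∈ b} = b := by
  ext z
  simp only [subsetCode, ZFSet.mem_sep, Set.mem_ofPred_eq]
  exact ⟨fun h => h.2.2, fun h => ⟨hb h, hb h, h⟩⟩

theorem subsetCode_subset_subsetCode {A B : Set k} :
    subsetCode k A ⊆ subsetCode k B ↔ A ⊆ B := by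
  refine ⟨fun h a ha => mem_subsetCode.1 (h (mem_subsetCode.2 ha)), fun h z hz => ?_⟩
  have hzk := subsetCode_subset A hz
  exact (mem_subsetCode (a := ⟨z, hzk⟩)).2 (h ((mem_subsetCode (a := ⟨z, hzk⟩)).1 hz))

theorem mem_ultrafilterCode {x : Ultrafilter k} {b : ZFSet.{u}} :
    b ∈ ultrafilterCode x ↔ b ⊆ k ∧ {a : k | (a : ZFSet.{u}) ∈ b} ∈ x := by
  simp [ultrafilterCode]

theorem subsetCode_mem_ultrafilterCode {x : Ultrafilter k} {A : Set k} :
    subsetCode k A ∈ ultrafilterCode x ↔ A ∈ x := by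
  rw [mem_ultrafilterCode, setOf_mem_subsetCode, and_iff_right (subsetCode_subset A)]

end Codes

theorem cardSet_card (κ : Cardinal.{u}) : (cardSet κ).card = κ := by
  simp [cardSet]

theorem mk_cardSet (κ : Cardinal.{u}) : #(cardSet κ) = lift.{u + 1} κ := by
  rw [ZFSet.cardinalMk_coe_sort, cardSet_card]

theorem cardSet_mono {κ μ : Cardinal.{u}} (h : κ ≤ μ) : cardSet κ ⊆ cardSet μ :=
  Ordinal.toZFSet_monotone (ord_le_ord.2 h)

/-! ### The property of a map into the ultrafilter that reflects to `M` -/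

/-- `Avoids K F u k`: the relation `K` is a partial function, and for every sequence
`q = (q_f)_{f ∈ F}`, coded by a relation, of down-directed families each of which fails to
generate some member of `F ∩ u`, there is `a ∈ k` with `K(a) ∈ u` and `K(a) ∉ q_f` for all
`f ∈ F`. All quantifiers range over `H(θ)`. -/
def Avoids {θ : Cardinal.{u}} (K F u k : HSet θ) : Prop :=
  (∀ a A A' : HSet θ, ZFSet.pair a.1 A ∈ K.1 → ZFSet.pair a.1 A' ∈ K.1 → A = A') ∧
  ∀ q : HSet θ,
    (∀ f : HSet θ, f.1 ∈ F.1 →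
      (∀ A B : HSet θ, ZFSet.pair f.1 A ∈ q.1 → ZFSet.pair f.1 B ∈ q.1 →
        ∃ C : HSet θ, ZFSet.pair f.1 C ∈ q.1 ∧ ∀ t : HSet θ, t.1 ∈ C.1 → t.1 ∈ A.1 ∧ t.1 ∈ B.1) ∧
      ∃ g : HSet θ, g.1 ∈ F.1 ∧ g.1 ∈ u.1 ∧ ∀ A : HSet θ, ZFSet.pair f.1 A ∈ q.1 →
        ¬ ∀ t : HSet θ, t.1 ∈ A.1 → t.1 ∈ g.1) →
    ∃ a : HSet θ, a.1 ∈ k.1 ∧ ∃ A : HSet θ, A.1 ∈ u.1 ∧ ZFSet.pair a.1 A ∈ K.1 ∧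
      ∀ f : HSet θ, f.1 ∈ F.1 → ¬ ZFSet.pair f.1 A ∈ q.1

theorem isDef_avoids {θ : Cardinal.{u}} : IsDef fun w : Fin 3 ⊕ Unit → HSet θ =>
    Avoids (w (Sum.inr ())) (w (Sum.inl 0)) (w (Sum.inl 1)) (w (Sum.inl 2)) := by
  unfold Avoids
  repeat' first
    | exact ⟨_, fun _ => rfl⟩
    | apply IsDef.mem
    | apply IsDef.pair_mem
    | apply IsDef.eq
    | apply IsDef.not
    | apply IsDef.and
    | apply IsDef.ex
    | apply IsDef.all
    | apply IsDef.imp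

/-- Every set `F ∈ H(θ)` of size `λ` admits a map into the good ultrafilter, itself an element of
`H(θ)`, that has the reflecting property. -/
theorem exists_avoids {κ lam θ : Cardinal.{u}} (x : Ultrafilter (cardSet κ)) (hx : IsGood x)
    (hlam : ℵ₀ ≤ lam) (hlamκ : lam < κ) (hθ : θ.IsRegular) (hκθ : 2 ^ κ < θ)
    (hJ : ¬ IsJonsson (Order.succ lam)) (F u k : HSet θ) (hF : F.1.card = lam)
    (hu : u.1 = ultrafilterCode x) (hk : k.1 = cardSet κ) : ∃ K : HSet θ, Avoids K F u k := by
  obtain ⟨k, hkH⟩ := k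
  obtain ⟨u, huH⟩ := u
  subst hk hu
  have hpowH : ∀ b ∈ (cardSet κ).powerset, b ∈ HSet θ := fun b hb =>
    subset_mem_HSet hkH (ZFSet.mem_powerset.1 hb)
  simp only [IsJonsson, not_forall, not_exists, not_and, not_not] at hJ
  obtain ⟨ψ, hψ⟩ := hJ
  have hIcard : #(cardSet (Order.succ lam)) = lift.{u + 1} (Order.succ lam) := mk_cardSet _
  have hJcard : #(F : ZFSet.{u}) = lift.{u + 1} lam := by rw [ZFSet.cardinalMk_coe_sort, hF]
  obtain ⟨K, hKx, hK⟩ := exists_avoiding_map hx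
    (Set.embeddingOfSubset _ _ (cardSet_mono (Order.succ_le_of_lt hlamκ)) :
      cardSet (Order.succ lam) ↪ cardSet κ)
    (J := (F : ZFSet.{u})) (by rw [hJcard]; simpa using hlam)
    (hIcard.trans (by rw [hJcard, lift_succ])) ψ (fun W hW => hψ W (hW.trans hIcard))
    (fun f => {a : cardSet κ | (a : ZFSet.{u}) ∈ (f : ZFSet.{u})})
  let Kc : ZFSet.{u} := ZFSet.range fun a : cardSet κ => ZFSet.pair a (subsetCode _ (K a))
  have hKc : Kc ∈ HSet θ := by
    refine mem_HSet_of_subset_prod hθ (a := cardSet κ) (b := (cardSet κ).powerset)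
      (fun z hz => mem_HSet_of_mem hkH hz) hpowH ?_ ?_ ?_
    · rw [cardSet_card]
      exact (cantor κ).trans hκθ
    · rwa [ZFSet.card_powerset, cardSet_card]
    · intro z hz
      obtain ⟨a, rfl⟩ := ZFSet.mem_range.1 hz
      exact ZFSet.pair_mem_prod.2 ⟨a.2, ZFSet.mem_powerset.2 (subsetCode_subset _)⟩
  have hKmem : ∀ a A : ZFSet.{u}, ZFSet.pair a A ∈ Kc ↔
      ∃ a' : cardSet κ, a = a' ∧ A = subsetCode _ (K a') := by
    intro a A
    simp only [Kc, ZFSet.mem_range, ZFSet.pair_inj]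
    exact ⟨fun ⟨a', h, h'⟩ => ⟨a', h.symm, h'.symm⟩, fun ⟨a', h, h'⟩ => ⟨a', h.symm, h'.symm⟩⟩
  refine ⟨⟨Kc, hKc⟩, fun a A A' hA hA' => ?_, fun q hq => ?_⟩
  · obtain ⟨b, hb, h⟩ := (hKmem _ _).1 hA
    obtain ⟨b', hb', h'⟩ := (hKmem _ _).1 hA'
    obtain rfl : b = b' := Subtype.ext (hb.symm.trans hb')
    exact Subtype.ext (h.trans h'.symm)
  have hcode : ∀ A : Set (cardSet κ), subsetCode _ A ∈ HSet θ := fun A =>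
    subset_mem_HSet hkH (subsetCode_subset A)
  have hFH : ∀ f : (F : ZFSet.{u}), (f : ZFSet.{u}) ∈ HSet θ := fun f => mem_HSet_of_mem F.2 f.2
  obtain ⟨a, ha⟩ := hK
    (fun f => {A | ZFSet.pair (f : ZFSet.{u}) (subsetCode _ A) ∈ (q : ZFSet.{u})})
    (fun f A hA B hB => by
      obtain ⟨⟨C, hCH⟩, hC, hCAB⟩ := (hq ⟨f, hFH f⟩ f.2).1 ⟨_, hcode A⟩ ⟨_, hcode B⟩ hA hB
      have hCAB' : ∀ t ∈ C, t ∈ subsetCode _ A ∧ t ∈ subsetCode _ B := fun t ht =>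
        hCAB ⟨t, mem_HSet_of_mem hCH ht⟩ ht
      have hCk : C ⊆ cardSet κ := fun t ht => subsetCode_subset A (hCAB' t ht).1
      refine ⟨{a | (a : ZFSet.{u}) ∈ C}, ?_, fun a ha =>
        ⟨mem_subsetCode.1 (hCAB' a ha).1, mem_subsetCode.1 (hCAB' a ha).2⟩⟩
      change ZFSet.pair (f : ZFSet.{u}) (subsetCode _ _) ∈ (q : ZFSet.{u})
      rwa [subsetCode_setOf_mem hCk])
    (fun f => by
      obtain ⟨g, hgF, hgu, hg⟩ := (hq ⟨f, hFH f⟩ f.2).2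
      refine ⟨⟨g, hgF⟩, (mem_ultrafilterCode.1 hgu).2, fun A hA hAg => ?_⟩
      refine hg ⟨_, hcode A⟩ hA fun t ht => ?_
      exact hAg ((mem_subsetCode (a := ⟨t, subsetCode_subset A ht⟩)).1 ht))
  exact ⟨⟨a, mem_HSet_of_mem hkH a.2⟩, a.2, ⟨_, hcode (K a)⟩,
    subsetCode_mem_ultrafilterCode.2 (hKx a), (hKmem _ _).2 ⟨a, rfl, rfl⟩,
    fun f hf => ha ⟨f, hf⟩⟩

/-! ### Ultrafilters of the trace algebra -/

/-- Two distinct ultrafilters of a Boolean algebra are incomparable. -/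
theorem StonePoint.exists_mem_notMem {B : Type v} [BooleanAlgebra B] {y p : StonePoint B}
    (h : p ≠ y) : ∃ b, b ∈ y.carrier ∧ b ∉ p.carrier := by
  by_contra! hyp
  refine h (StonePoint.ext (Set.Subset.antisymm (fun b hb => ?_) hyp))
  refine (y.mem_or_compl_mem b).resolve_right fun hbc => p.bot_notMem ?_
  simpa using p.inf_mem _ _ hb (hyp _ hbc)

/-- The strong form of the conclusion: at most `λ` ultrafilters of `P(κ) ∩ M`, each omitting some
set of `x`, all omit a common set of `x`. -/
theorem exists_mem_forall_notMem {κ lam θ : Cardinal.{u}}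
    (x : Ultrafilter (cardSet κ)) (hx : IsGood x)
    (hlam : ℵ₀ ≤ lam) (hlamκ : lam < κ) (hθ : θ.IsRegular) (hκθ : 2 ^ κ < θ)
    (M : setLanguage.ElementarySubstructure (HSet θ))
    (hxM : ultrafilterCode x ∈ modelSets M) (hκM : cardSet κ ∈ modelSets M)
    (hκsub : (cardSet κ : Set ZFSet.{u}) ⊆ modelSets M)
    (hcov : IsCovering lam (modelSets M)) (hJ : ¬ IsJonsson (Order.succ lam))
    (S : Set (StonePoint (traceAlgebra M hκM))) (hS : #S ≤ lift.{u + 1} lam) (hne : S.Nonempty)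
    (hSx : ∀ p ∈ S, ∃ b, b ∈ (stoneRestrict (traceAlgebra M hκM) x).carrier ∧ b ∉ p.carrier) :
    ∃ A : traceAlgebra M hκM, (A : Set (cardSet κ)) ∈ x ∧ ∀ p ∈ S, A ∉ p.carrier := by
  choose! b hbx hbp using hSx
  have : Small.{u} S := by
    rw [small_iff_lift_mk_lt_univ]
    refine (lift_le.2 hS).trans_lt ?_
    simpa using lift_lt_univ' lam
  -- The chosen sets, padded with the ordinals below `λ` to get exactly `λ` elements.
  let E : ZFSet.{u} := (ZFSet.range fun p : S => subsetCode (cardSet κ) (b p)) ∪ cardSet lam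
  have hEM : (E : Set ZFSet.{u}) ⊆ modelSets M := by
    intro z hz
    rcases ZFSet.mem_union.1 hz with hz | hz
    · obtain ⟨p, rfl⟩ := ZFSet.mem_range.1 hz
      exact (b p).2
    · exact hκsub (cardSet_mono hlamκ.le hz)
  have hEcard : E.card = lam := by
    refine le_antisymm ?_ ?_
    · refine ZFSet.card_union_le.trans (add_le_of_le hlam ?_ (cardSet_card lam).le)
      rw [← lift_le.{u + 1}]
      refine le_trans ?_ hS
      exact (ZFSet.lift_card_range_le (f := fun p : S => subsetCode (cardSet κ) (b p))).trans_eq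
        (lift_id'.{u, u + 1} _)
    · calc lam = (cardSet lam).card := (cardSet_card lam).symm
        _ ≤ E.card := ZFSet.card_mono fun z hz => ZFSet.mem_union.2 (Or.inr hz)
  obtain ⟨F, hFsub, hFcard, hEF, hFH, hFM⟩ := hcov E hEM hEcard
  obtain ⟨hxH, hxM⟩ := hxM
  obtain ⟨hkH, hkM⟩ := id hκM
  obtain ⟨⟨K, hKH⟩, hKM, hK⟩ := isDef_avoids.exists_mem M
    ![⟨F, hFH⟩, ⟨ultrafilterCode x, hxH⟩, ⟨cardSet κ, hkH⟩]
    (by intro i; fin_cases i <;> assumption)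
    (exists_avoids x hx hlam hlamκ hθ hκθ hJ _ _ _ hFcard rfl rfl)
  replace hK : Avoids ⟨K, hKH⟩ ⟨F, hFH⟩ ⟨ultrafilterCode x, hxH⟩ ⟨cardSet κ, hkH⟩ := hK
  -- The ultrafilters in `S`, listed (with repetitions) along `F`.
  obtain ⟨e, he⟩ : ∃ e : F → S, Function.Surjective e := by
    have hSF : #S ≤ #F := by rwa [ZFSet.cardinalMk_coe_sort, hFcard]
    obtain ⟨f⟩ := hSF
    have : Nonempty S := hne.to_subtype
    exact ⟨Function.invFun f, Function.invFun_surjective f.injective⟩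
  let q : ZFSet.{u} := ZFSet.sep (fun z => ∃ f : F, ∃ A ∈ (e f).1.carrier,
    z = ZFSet.pair f (subsetCode (cardSet κ) A)) (ZFSet.prod F (cardSet κ).powerset)
  have hqmem : ∀ (f : F) (A : traceAlgebra M hκM),
      ZFSet.pair (f : ZFSet.{u}) (subsetCode (cardSet κ) A) ∈ q ↔ A ∈ (e f).1.carrier := by
    intro f A
    simp only [q, ZFSet.mem_sep, ZFSet.pair_mem_prod, ZFSet.mem_powerset, ZFSet.pair_inj]
    constructor
    · rintro ⟨-, f', A', hA', hf, hA⟩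
      obtain rfl : f = f' := Subtype.ext hf
      obtain rfl : A = A' := Subtype.ext <| by
        rw [← setOf_mem_subsetCode (A : Set (cardSet κ)), hA, setOf_mem_subsetCode]
      exact hA'
    · exact fun h => ⟨⟨f.2, subsetCode_subset _⟩, f, A, h, rfl, rfl⟩
  have hqex : ∀ (f : F) (A : ZFSet.{u}), ZFSet.pair (f : ZFSet.{u}) A ∈ q →
      ∃ A' ∈ (e f).1.carrier, A = subsetCode (cardSet κ) A' := by
    intro f A hA
    obtain ⟨-, f', A', hA', h⟩ := ZFSet.mem_sep.1 hA
    obtain ⟨hf, hA⟩ := ZFSet.pair_inj.1 h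
    obtain rfl : f = f' := Subtype.ext hf
    exact ⟨A', hA', hA⟩
  have hqH : q ∈ HSet θ := by
    refine mem_HSet_of_subset_prod hθ (a := F) (b := (cardSet κ).powerset)
      (fun z hz => mem_HSet_of_mem hFH hz)
      (fun z hz => subset_mem_HSet hkH (ZFSet.mem_powerset.1 hz)) ?_ ?_
      (fun z hz => (ZFSet.mem_sep.1 hz).1)
    · rw [hFcard]
      exact hlamκ.trans ((cantor κ).trans hκθ)
    · rwa [ZFSet.card_powerset, cardSet_card]
  have hcode : ∀ A : Set (cardSet κ), subsetCode _ A ∈ HSet θ := fun A =>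
    subset_mem_HSet hkH (subsetCode_subset A)
  obtain ⟨⟨a, haH⟩, hak, ⟨A, hAH⟩, hAu, haA, hAq⟩ := hK.2 ⟨q, hqH⟩ fun ⟨f, hfH⟩ hf => by
    refine ⟨fun ⟨A, _⟩ ⟨B, _⟩ hA hB => ?_, ?_⟩
    · obtain ⟨A', hA', rfl⟩ := hqex ⟨f, hf⟩ A hA
      obtain ⟨B', hB', rfl⟩ := hqex ⟨f, hf⟩ B hB
      refine ⟨⟨_, hcode (A' ⊓ B' : traceAlgebra M hκM)⟩,
        (hqmem ⟨f, hf⟩ (A' ⊓ B')).2 (StonePoint.inf_mem _ _ _ hA' hB'), fun t ht => ?_⟩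
      exact ⟨(subsetCode_subset_subsetCode (A := A'.1 ∩ B')).2 Set.inter_subset_left ht,
        (subsetCode_subset_subsetCode (A := A'.1 ∩ B')).2 Set.inter_subset_right ht⟩
    · have hp := (e ⟨f, hf⟩).2
      refine ⟨⟨_, hcode (b (e ⟨f, hf⟩))⟩, hEF (ZFSet.mem_union.2 (Or.inl (ZFSet.mem_range.2
        ⟨e ⟨f, hf⟩, rfl⟩))), subsetCode_mem_ultrafilterCode.2 (hbx _ hp), ?_⟩
      rintro ⟨A, hAH⟩ hA hAb
      obtain ⟨A', hA', rfl⟩ := hqex ⟨f, hf⟩ A hA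
      refine hbp _ hp (StonePoint.mem_of_le _ A' _ hA' ?_)
      exact subsetCode_subset_subsetCode.1 fun t ht => hAb ⟨t, mem_HSet_of_mem hAH ht⟩ ht
  -- The value of `K ∈ M` at `a ∈ κ ⊆ M` lies in `M`.
  have hAM : A ∈ modelSets M := by
    obtain ⟨_, haM⟩ := hκsub hak
    have hdef : IsDef fun w : Fin 2 ⊕ Unit → HSet θ =>
        ZFSet.pair (w (Sum.inl 0)).1 (w (Sum.inr ())) ∈ (w (Sum.inl 1)).1 :=
      IsDef.pair_mem ⟨_, fun _ => rfl⟩ ⟨_, fun _ => rfl⟩ ⟨_, fun _ => rfl⟩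
    obtain ⟨A', hA'M, hA'⟩ := hdef.exists_mem M ![⟨a, haH⟩, ⟨K, hKH⟩]
      (by intro i; fin_cases i <;> assumption) ⟨⟨A, hAH⟩, haA⟩
    rw [← hK.1 ⟨a, haH⟩ ⟨A, hAH⟩ A' haA hA'] at hA'M
    exact ⟨hAH, hA'M⟩
  obtain ⟨hAk, hAx⟩ := mem_ultrafilterCode.1 (show A ∈ ultrafilterCode x from hAu)
  refine ⟨⟨_, show subsetCode (cardSet κ) {a | (a : ZFSet.{u}) ∈ A} ∈ modelSets M by
    rwa [subsetCode_setOf_mem hAk]⟩, hAx, fun p hp hAp => ?_⟩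
  obtain ⟨f, hf⟩ := he ⟨p, hp⟩
  refine hAq ⟨f, mem_HSet_of_mem hFH f.2⟩ f.2 ?_
  have h := (hqmem f ⟨_, show subsetCode (cardSet κ) {a | (a : ZFSet.{u}) ∈ A} ∈ modelSets M by
    rwa [subsetCode_setOf_mem hAk]⟩).2 (by rw [hf]; exact hAp)
  rwa [subsetCode_setOf_mem hAk] at h

theorem lemma7 (κ lam θ : Cardinal.{u}) (hκ : ℵ₀ ≤ κ)
    (x : Ultrafilter (cardSet κ)) (hx : IsGood x)
    (hlam : ℵ₀ ≤ lam) (hlamκ : lam < κ)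
    (hθ : θ.IsRegular) (hκθ : 2 ^ κ < θ)
    (M : setLanguage.ElementarySubstructure (HSet θ))
    (hxM : ultrafilterCode x ∈ modelSets M) (hκM : cardSet κ ∈ modelSets M)
    (hκsub : (cardSet κ : Set ZFSet.{u}) ⊆ modelSets M)
    (hcov : IsCovering lam (modelSets M))
    (hJ : ¬ IsJonsson (Order.succ lam)) :
    IsWeakPPoint (lift.{u + 1} (Order.succ lam)) (stoneRestrict (traceAlgebra M hκM) x) := by
  intro S hSx hS hcl
  have hne : S.Nonempty := closure_nonempty_iff.1 ⟨_, hcl⟩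
  rw [lift_succ, Order.lt_succ_iff] at hS
  obtain ⟨A, hAx, hA⟩ := exists_mem_forall_notMem x hx hlam hlamκ hθ hκθ M hxM hκM hκsub hcov hJ
    S hS hne fun p hp => StonePoint.exists_mem_notMem (hSx hp)
  have hopen : IsOpen {p : StonePoint (traceAlgebra M hκM) | A ∈ p.carrier} :=
    TopologicalSpace.isOpen_generateFrom_of_mem ⟨A, rfl⟩
  obtain ⟨p, hpA, hpS⟩ := mem_closure_iff.1 hcl _ hopen hAx
  exact hA p hpS hpA
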